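/- Let $G$ be a finite directed graph with vertex set $V$ (loops, multiple edges and directed cycles are allowed). Let $R$ be a commutative ring, and give each edge $e$ of $G$ its own commuting variable $x_e$. The weight of a path or cycle is the product of the variables of its edges, counted with multiplicity; a path with no edges has weight $1$. Let $A$ be the weighted adjacency matrix, so that $A_{uv}$ is the sum of $x_e$ over all edges $e$ from $u$ to $v$. Let $M$ be the weighted path matrix, so that $M_{uv}=\sum_{P:u\leadsto v}\operatorname{wt}(P)$ is the formal power series over $R$ obtained by summing over all directed paths from $u$ to $v$, self-intersections allowed. Then $I-A$ is invertible over the ring of formal power series and $M=(I-A)^{-1}$. A path is self-avoiding if it visits no vertex twice. A self-avoiding cycle has at least one edge, visits no vertex twice before it closes up, and is considered up to the choice of its starting point. Let $\mathcal C(G)$ be the set of all collections $\mathbf C$, including the empty one, of pairwise vertex-disjoint self-avoiding cycles. Let $\operatorname{sgn}(\mathbf C)=(-1)^{|\mathbf C|}$, where $|\mathbf C|$ is the number of cycles, and let $\operatorname{wt}(\mathbf C)$ be the product of the weights of the cycles. For $k\ge 0$, let $a_1,\dots,a_k\in V$ be distinct and let $b_1,\dots,b_k\in V$ be distinct; the sets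 $\mathcal{A}=\{a_1,\dots,a_k\}$ and $\mathcal{B}=\{b_1,\dots,b_k\}$ may intersect. A self-avoiding flow $\mathbf F$ from $\mathcal{A}$ to $\mathcal{B}$ consists of a permutation $\pi\in S_k$, self-avoiding paths $P_i:a_i\leadsto b_{\pi(i)}$ for $1\le i\le k$, and a collection $\mathbf C\in\mathcal C(G)$, such that all these paths and cycles are pairwise vertex-disjoint. Let $\operatorname{sgn}(\mathbf F)=\operatorname{sgn}(\pi)(-1)^{|\mathbf C|}$ and $\operatorname{wt}(\mathbf F)=\operatorname{wt}(\mathbf C)\prod_i\operatorname{wt}(P_i)$. Let $\mathcal F_{\mathcal{A},\mathcal{B}}(G)$ be the set of all such flows. Then the polynomial $\sum_{\mathbf C\in\mathcal C(G)}\operatorname{sgn}(\mathbf C)\operatorname{wt}(\mathbf C)$ is invertible as a formal power series over $R$, and for all such $a_1,\dots,a_k$ and $b_1,\dots,b_k$ the minor of $M$ with $i$-th row indexed by $a_i$ and $j$-th column indexed by $b_j$ is $$\det\bigl(M_{a_i b_j}\bigr)_{i,j=1}^k=\frac{\sum_{\mathbf F\in\mathcal F_{\mathcal{A},\mathcal{B}}(G)}\operatorname{sgn}(\mathbf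 F)\operatorname{wt}(\mathbf F)}{\sum_{\mathbf C\in\mathcal C(G)}\operatorname{sgn}(\mathbf C)\operatorname{wt}(\mathbf C)},$$ a ratio of two polynomials in the edge variables. -/

import Mathlib

/-- A directed graph with vertex set `V` and edge set `E`; each edge points from its tail to its
head.  Loops, multiple edges and directed cycles are allowed. -/
structure DirectedGraph (V E : Type*) where
  tail : E → V
  head : E → V

namespace DirectedGraph

section Paths

variable {V E : Type*} (G : DirectedGraph V E)

/-- `G.IsPath u v l`: traversing the edges of `l` in order leads from `u` to `v`. -/
def IsPath : V → V → List E → Prop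
  | u, v, [] => u = v
  | u, v, e :: l => G.tail e = u ∧ IsPath (G.head e) v l

/-- A directed path from `u` to `v` (self-intersections allowed); the trivial path has no edges. -/
@[ext]
structure Path (u v : V) where
  edges : List E
  isPath : G.IsPath u v edges

variable {G}

/-- The vertices visited by a path, in order and with repetitions. -/
def Path.vertices {u v : V} (P : G.Path u v) : List V :=
  u :: P.edges.map G.head

def Path.vertexSet {u v : V} (P : G.Path u v) : Set V :=
  {w | w ∈ P.vertices}

def Path.IsSelfAvoiding {u v : V} (P : G.Path u v) : Prop :=
  P.vertices.Nodup

/-- The product of the edge variables along the path. -/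
noncomputable def Path.weight (R : Type*) [CommRing R] {u v : V} (P : G.Path u v) :
    MvPolynomial E R :=
  (P.edges.map MvPolynomial.X).prod

variable (G)

/-- A self-avoiding cycle: a nonempty cyclic sequence of edges, each ending where the next one
starts, whose vertices are pairwise distinct. -/
@[ext]
structure SelfAvoidingCycle where
  edges : Cycle E
  ne_nil : edges ≠ Cycle.nil
  chain : edges.Chain fun e f => G.head e = G.tail f
  nodup : (edges.map G.tail).Nodup

variable {G}

def SelfAvoidingCycle.vertexSet (c : G.SelfAvoidingCycle) : Set V :=
  {w | w ∈ c.edges.map G.tail}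

noncomputable def SelfAvoidingCycle.weight (R : Type*) [CommRing R] (c : G.SelfAvoidingCycle) :
    MvPolynomial E R :=
  (c.edges.toMultiset.map MvPolynomial.X).prod

variable (G)

/-- A (finite, possibly empty) collection of pairwise vertex-disjoint self-avoiding cycles. -/
@[ext]
structure CycleCollection where
  cycles : Finset G.SelfAvoidingCycle
  disjoint : (cycles : Set G.SelfAvoidingCycle).PairwiseDisjoint SelfAvoidingCycle.vertexSet

variable {G}

def CycleCollection.sign (C : G.CycleCollection) : ℤˣ :=
  (-1) ^ C.cycles.card

noncomputable def CycleCollection.weight (R : Type*) [CommRing R] (C : G.CycleCollection) :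
    MvPolynomial E R :=
  ∏ c ∈ C.cycles, c.weight R

variable (G)

/-- A family of paths joining `a i` to `b (π i)` for some permutation `π`. -/
structure PathCollection {k : ℕ} (a b : Fin k → V) where
  perm : Equiv.Perm (Fin k)
  path : ∀ i, G.Path (a i) (b (perm i))

variable {G}

def PathCollection.sign {k : ℕ} {a b : Fin k → V} (P : G.PathCollection a b) : ℤˣ :=
  Equiv.Perm.sign P.perm

noncomputable def PathCollection.weight (R : Type*) [CommRing R] {k : ℕ} {a b : Fin k → V}
    (P : G.PathCollection a b) : MvPolynomial E R :=
  ∏ i, (P.path i).weight R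

variable (G)

/-- A self-avoiding flow: self-avoiding paths from the `a i` to the `b j` and self-avoiding
cycles, all of them pairwise vertex-disjoint. -/
structure SelfAvoidingFlow {k : ℕ} (a b : Fin k → V) where
  paths : G.PathCollection a b
  cycles : G.CycleCollection
  selfAvoiding : ∀ i, (paths.path i).IsSelfAvoiding
  paths_disjoint : ∀ i j, i ≠ j →
    Disjoint (paths.path i).vertexSet (paths.path j).vertexSet
  paths_cycles_disjoint : ∀ i, ∀ c ∈ cycles.cycles,
    Disjoint (paths.path i).vertexSet c.vertexSet

variable {G}

def SelfAvoidingFlow.sign {k : ℕ} {a b : Fin k → V} (F : G.SelfAvoidingFlow a b) : ℤˣ :=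
  F.paths.sign * F.cycles.sign

noncomputable def SelfAvoidingFlow.weight (R : Type*) [CommRing R] {k : ℕ} {a b : Fin k → V}
    (F : G.SelfAvoidingFlow a b) : MvPolynomial E R :=
  F.paths.weight R * F.cycles.weight R

end Paths

section Finiteness

variable {V E : Type*} (G : DirectedGraph V E)

instance instFiniteSelfAvoidingCycle [Finite E] : Finite G.SelfAvoidingCycle := by
  classical
  have := Fintype.ofFinite E
  have key : ∀ c : G.SelfAvoidingCycle, c.edges.Nodup := by
    intro c
    have h := c.nodup
    generalize c.edges = s at h
    induction s using Quotient.inductionOn' with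
    | h l => exact List.Nodup.of_map G.tail h
  refine Finite.of_injective
    (fun c : G.SelfAvoidingCycle => (⟨c.edges, key c⟩ : {s : Cycle E // s.Nodup})) ?_
  intro c d h
  exact SelfAvoidingCycle.ext (congrArg Subtype.val h)

instance instFiniteCycleCollection [Finite E] : Finite G.CycleCollection :=
  Finite.of_injective CycleCollection.cycles fun _ _ h => CycleCollection.ext h

instance instFiniteSelfAvoidingPath [Finite E] (u v : V) :
    Finite {P : G.Path u v // P.IsSelfAvoiding} := by
  classical
  have := Fintype.ofFinite E
  have key : ∀ P : {P : G.Path u v // P.IsSelfAvoiding}, P.1.edges.Nodup := fun P =>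
    List.Nodup.of_map G.head (List.nodup_cons.1 P.2).2
  refine Finite.of_injective (fun P : {P : G.Path u v // P.IsSelfAvoiding} =>
    (⟨P.1.edges, key P⟩ : {l : List E // l.Nodup})) ?_
  intro P Q h
  exact Subtype.ext (Path.ext (congrArg Subtype.val h))

instance instFiniteSelfAvoidingFlow [Finite E] {k : ℕ} (a b : Fin k → V) :
    Finite (G.SelfAvoidingFlow a b) := by
  refine Finite.of_injective (β := (Σ π : Equiv.Perm (Fin k),
      ∀ i, {P : G.Path (a i) (b (π i)) // P.IsSelfAvoiding}) × G.CycleCollection)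
    (fun F => (⟨F.paths.perm, fun i => ⟨F.paths.path i, F.selfAvoiding i⟩⟩, F.cycles)) ?_
  rintro ⟨⟨π, P⟩, C, h₁, h₂, h₃⟩ ⟨⟨π', P'⟩, C', h₁', h₂', h₃'⟩ h
  simp only [Prod.mk.injEq, Sigma.mk.injEq] at h
  obtain ⟨⟨rfl, h⟩, rfl⟩ := h
  have : P = P' := by
    funext i
    exact congrArg Subtype.val (congrFun (eq_of_heq h) i)
  subst this
  rfl

noncomputable instance instFintypeCycleCollection [Finite E] : Fintype G.CycleCollection :=
  Fintype.ofFinite _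

noncomputable instance instFintypeSelfAvoidingFlow [Finite E] {k : ℕ} (a b : Fin k → V) :
    Fintype (G.SelfAvoidingFlow a b) :=
  Fintype.ofFinite _

/-- Only finitely many paths from `u` to `v` contribute to a given coefficient, so that the sum
of the weights of all these paths is a well-defined formal power series. -/
theorem finite_path_coeff_ne_zero [Finite E] (R : Type*) [CommRing R] (u v : V) (d : E →₀ ℕ) :
    {P : G.Path u v |
      MvPowerSeries.coeff d (P.weight R : MvPowerSeries E R) ≠ 0}.Finite := by
  refine Set.Finite.of_finite_image
    (f := Path.edges) ?_ (fun P _ Q _ h => Path.ext h)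
  refine (List.finite_length_eq E d.degree).subset ?_
  rintro _ ⟨P, hP, rfl⟩
  have hom : (P.weight R).IsHomogeneous P.edges.length := by
    unfold Path.weight
    generalize P.edges = l
    induction l with
    | nil => simpa using MvPolynomial.isHomogeneous_one E R
    | cons e l ih =>
      have := (MvPolynomial.isHomogeneous_X R e).mul ih
      simpa [add_comm] using this
  have hP' : MvPolynomial.coeff d (P.weight R) ≠ 0 := by
    simpa [MvPolynomial.coeff_coe] using hP
  by_contra hne
  exact hP' (hom.coeff_eq_zero (fun h => hne h.symm))

end Finiteness

section Matrices

variable {V E : Type*} (G : DirectedGraph V E) (R : Type*) [CommRing R]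

/-- The weighted path matrix: its `(u, v)` entry is the formal power series `∑ wt(P)` over all
paths `P` from `u` to `v`, the sum being formed coefficient by coefficient. -/
noncomputable def pathMatrix : Matrix V V (MvPowerSeries E R) :=
  Matrix.of fun u v => fun d =>
    ∑ᶠ P : G.Path u v, MvPowerSeries.coeff d (P.weight R : MvPowerSeries E R)

open Classical in
/-- The weighted adjacency matrix: its `(u, v)` entry is the sum of the variables of all edges
from `u` to `v`. -/
noncomputable def adjacencyMatrix [Fintype E] : Matrix V V (MvPowerSeries E R) :=
  Matrix.of fun u v =>
    ∑ e : E with G.tail e = u ∧ G.head e = v, MvPowerSeries.X e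

/-- The signed weighted sum over all self-avoiding flows. -/
noncomputable def flowPolynomial [Finite E] {k : ℕ} (a b : Fin k → V) : MvPolynomial E R :=
  ∑ F : G.SelfAvoidingFlow a b, F.sign • F.weight R

/-- The signed weighted sum over all collections of vertex-disjoint self-avoiding cycles. -/
noncomputable def cyclePolynomial [Finite E] : MvPolynomial E R :=
  ∑ C : G.CycleCollection, C.sign • C.weight R

end Matrices

end DirectedGraph

/-! Border `1 - A` by one row for each source and one column for each sink. By the Schur complement
the resulting determinant is `det (1 - A)` times the minor of `M`. It remains to identify this
determinant with the signed sum over flows; the case of no sources then gives `det (1 - A)` as the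
cycle polynomial, so the quotient is the minor. The identification is an induction on the edge set,
as both sides obey the same recursion. Adding an edge `e` is a rank one change of `1 - A`, so the
determinant drops by `x_e` times the determinant with one more source, the head of `e`, and one more
sink, its tail (`det_borderedMatrix_insert`). A flow that uses `e` can be cut there: a path falls
into two paths, a cycle opens into one. Either way the result is a flow in the smaller graph with
that same new source and sink, and the sign flips. `EdgeFlow.join` is the inverse operation. No
cancelling pairs of flows are needed, and the inverse of `1 - A` enters only in the Schur
complement. -/

/-! ### Bordered determinants -/

namespace Matrix

/-- A rank one perturbation changes the determinant by a bordered determinant. -/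
theorem det_add_smul_vecMulVec {n T : Type*} [Fintype n] [DecidableEq n] [CommRing T]
    (B : Matrix n n T) (x : T) (u v : n → T) :
    (B + x • vecMulVec u v).det =
      B.det - x * (fromBlocks B (replicateCol Unit u) (replicateRow Unit v) 0).det := by
  set N := fromBlocks B (replicateCol Unit u) (replicateRow Unit v) 0 with hN
  -- With corner entry `1` the Schur complement is the perturbed matrix; splitting the last row as
  -- `-x • (v, 0) + (0, 1)` then gives the two terms.
  have h1 : fromBlocks B (replicateCol Unit u) (replicateRow Unit ((-x) • v)) 1 =
      N.updateRow (Sum.inr ()) ((-x) • Sum.elim v (0 : Unit → T) + Sum.elim (0 : n → T) (1 : Unit → T)) := by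
    ext (i | i) (j | j) <;> simp [hN, updateRow_apply]
  have h2 : N.updateRow (Sum.inr ()) (Sum.elim v (0 : Unit → T)) = N := by
    ext (i | i) (j | j) <;> simp [hN, updateRow_apply]
  have h3 : N.updateRow (Sum.inr ()) (Sum.elim (0 : n → T) (1 : Unit → T)) =
      fromBlocks B (replicateCol Unit u) 0 1 := by
    ext (i | i) (j | j) <;> simp [hN, updateRow_apply]
  have h4 : B + x • vecMulVec u v =
      B - replicateCol Unit u * replicateRow Unit ((-x) • v) := by
    ext i j
    simp [vecMulVec_apply, mul_apply]
    ring
  rw [h4, ← det_fromBlocks_one₂₂, h1, det_updateRow_add, det_updateRow_smul, h2, h3,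
    det_fromBlocks_zero₂₁, det_one]
  ring

end Matrix

namespace DirectedGraph

variable {V E : Type*} [Fintype V] [DecidableEq V] (G : DirectedGraph V E)
  {T : Type*} [CommRing T] (w : E → T)

/-- The weighted adjacency matrix of the subgraph with edge set `S`. -/
def partialAdjacency (S : Finset E) : Matrix V V T :=
  ∑ e ∈ S, w e • Matrix.vecMulVec (Pi.single (G.tail e) 1) (Pi.single (G.head e) 1)

/-- The matrix `1 - A` of the subgraph with edge set `S`, bordered by one row for each source `a i`
and one column for each sink `b j`. -/
def borderedMatrix (S : Finset E) {ι : Type} [DecidableEq ι] (a b : ι → V) :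
    Matrix (V ⊕ ι) (V ⊕ ι) T :=
  Matrix.fromBlocks (1 - G.partialAdjacency w S) (-(1 : Matrix V V T).submatrix id b)
    ((1 : Matrix V V T).submatrix a id) 0

/-- The edge subtracts `w e` at the entry (tail, head). The column and row of this rank one term
have exactly the form of a border by a new sink and a new source, indexed by `none`. -/
theorem det_borderedMatrix_insert [DecidableEq E] {S : Finset E} {e : E} (he : e ∉ S)
    {ι : Type} [DecidableEq ι] [Fintype ι] (a b : ι → V) :
    (G.borderedMatrix w (insert e S) a b).det =
      (G.borderedMatrix w S a b).det - w e *
        (G.borderedMatrix w S (fun i : Option ι => i.elim (G.head e) a)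
          (fun i => i.elim (G.tail e) b)).det := by
  have h1 : G.borderedMatrix w (insert e S) a b = G.borderedMatrix w S a b +
      w e • Matrix.vecMulVec (-Pi.single (Sum.inl (G.tail e)) 1)
        (Pi.single (Sum.inl (G.head e)) 1) := by
    ext (i | i) (j | j)
    · simp [borderedMatrix, partialAdjacency, Finset.sum_insert he, Matrix.vecMulVec_apply,
        Pi.single_apply]
      ring
    · simp [borderedMatrix, Matrix.vecMulVec_apply]
    · simp [borderedMatrix, Matrix.vecMulVec_apply]
    · simp [borderedMatrix, Matrix.vecMulVec_apply]
  let φ : V ⊕ Option ι ≃ (V ⊕ ι) ⊕ Unit :=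
    ((Equiv.refl V).sumCongr (Equiv.optionEquivSumPUnit ι)).trans (Equiv.sumAssoc V ι Unit).symm
  rw [h1, Matrix.det_add_smul_vecMulVec, ← Matrix.det_submatrix_equiv_self φ]
  congr 3
  ext (i | _ | i) (j | _ | j) <;>
    simp [φ, borderedMatrix, Pi.single_apply, Matrix.one_apply, eq_comm (a := G.head e)] <;> rfl

theorem det_borderedMatrix_empty {ι : Type} [DecidableEq ι] [Fintype ι] (a b : ι → V) :
    (G.borderedMatrix w ∅ a b).det = ((1 : Matrix V V T).submatrix a b).det := by
  rw [borderedMatrix, partialAdjacency, Finset.sum_empty, sub_zero, Matrix.det_fromBlocks_one₁₁]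
  congr 1
  ext i j
  simp [Matrix.mul_apply, Matrix.one_apply]

/-- The Schur complement of `1 - A` selects rows `a` and columns `b` of its inverse; the minus sign
in the sink block cancels the one in the complement. -/
theorem det_borderedMatrix_of_right_inverse (S : Finset E) {M : Matrix V V T}
    (hM : (1 - G.partialAdjacency w S) * M = 1) {ι : Type} [DecidableEq ι] [Fintype ι]
    (a b : ι → V) :
    (G.borderedMatrix w S a b).det =
      (1 - G.partialAdjacency w S).det * (M.submatrix a b).det := by
  let _ : Invertible (1 - G.partialAdjacency w S) := ⟨M, mul_eq_one_comm.1 hM, hM⟩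
  have hinv : ⅟(1 - G.partialAdjacency w S) = M := invOf_eq_right_inv hM
  rw [borderedMatrix, Matrix.det_fromBlocks₁₁, hinv]
  congr 2
  ext i j
  simp [Matrix.mul_apply, Matrix.one_apply]

end DirectedGraph

/-! ### Flows given by lists of edges -/

namespace DirectedGraph

variable {V E : Type*} (G : DirectedGraph V E)

variable {G} in
theorem IsPath.append_cons_iff {u v : V} {l₁ l₂ : List E} {e : E} :
    G.IsPath u v (l₁ ++ e :: l₂) ↔ G.IsPath u (G.tail e) l₁ ∧ G.IsPath (G.head e) v l₂ := by
  induction l₁ generalizing u with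
  | nil => simp [IsPath, eq_comm]
  | cons f l ih => simp [IsPath, ih, and_assoc]

variable {G} in
theorem IsPath.isChain_iff {e f : E} {l : List E} :
    (e :: (l ++ [f])).IsChain (fun e f => G.head e = G.tail f) ↔
      G.IsPath (G.head e) (G.tail f) l := by
  induction l generalizing e with
  | nil => simp [IsPath]
  | cons g l ih => simp [IsPath, ih, eq_comm (a := G.tail g)]

variable {G} in
theorem IsPath.cons_map_head {u v : V} {l : List E} (h : G.IsPath u v l) :
    u :: l.map G.head = l.map G.tail ++ [v] := by
  induction l generalizing u with
  | nil => simpa [IsPath] using h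
  | cons e l ih => simp [← h.1, ih h.2]

/-- A closed walk enters each vertex as often as it leaves it. Hence heads alone can record the
vertices of cycles, as they do for paths apart from the source. -/
theorem map_head_eq_map_tail {c : Cycle E} (h : c.Chain fun e f => G.head e = G.tail f) :
    c.toMultiset.map G.head = c.toMultiset.map G.tail := by
  induction c using Quotient.inductionOn' with
  | h l =>
    cases l with
    | nil => rfl
    | cons e l =>
      have h1 := ((Cycle.chain_coe_cons _ _ _).1 h)
      have h2 := (IsPath.isChain_iff.1 h1).cons_map_head
      change (((e :: l).map G.head : List V) : Multiset V) = ((e :: l).map G.tail : List V)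
      rw [List.map_cons, h2, Multiset.coe_eq_coe]
      simp

/-- If two cyclic sequences agree and the first element occurs only once, then so do the lists. -/
theorem _root_.Cycle.coe_cons_inj_of_notMem {e : E} {l l' : List E} (hl' : e ∉ l') :
    ((e :: l : List E) : Cycle E) = (e :: l' : List E) ↔ l = l' := by
  refine ⟨fun h => ?_, fun h => by rw [h]⟩
  obtain ⟨n, hn, h⟩ := List.isRotated_iff_mod.1 (Quotient.exact h)
  rw [List.rotate_eq_drop_append_take hn] at h
  cases n with
  | zero => simpa using h
  | succ n =>
    rw [List.drop_succ_cons, List.take_succ_cons] at h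
    -- Either the rotation is a full turn, or the `e` leading the first list lands inside `l'`.
    rcases hd : l.drop n with _ | ⟨f, m⟩
    · have : l.length ≤ n := by simpa using hd
      have hn' : n = l.length := by simp at hn; omega
      simpa [hd, hn'] using h
    · rw [hd] at h
      simp only [List.cons_append, List.cons.injEq] at h
      exact absurd (h.2 ▸ by simp) hl'

theorem _root_.Cycle.exists_eq_coe_cons {e : E} {c : Cycle E} (h : e ∈ c) :
    ∃ l : List E, c = (e :: l : List E) := by
  induction c using Quotient.inductionOn' with
  | h l =>
    obtain ⟨s, t, rfl⟩ := List.append_of_mem (Cycle.mem_coe_iff.1 h)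
    refine ⟨t ++ s, Quotient.sound ?_⟩
    exact List.isRotated_append (l := s) (l' := e :: t)

theorem _root_.Cycle.mem_toMultiset {e : E} {c : Cycle E} : e ∈ c.toMultiset ↔ e ∈ c := by
  induction c using Quotient.inductionOn' with
  | h l => rfl

/-- Lists of edges indexed by `ι` and a finite set of cyclic sequences of edges, together with a
permutation of `ι`; no compatibility is required. -/
@[ext]
structure EdgeFlow (ι : Type) (E : Type*) where
  perm : Equiv.Perm ι
  path : ι → List E
  cycles : Finset (Cycle E)

namespace EdgeFlow

variable {ι : Type}

theorem exists_perm_some_eq_none {σ : Equiv.Perm (Option ι)} (h : σ none ≠ none) :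
    ∃ m, σ (some m) = none := by
  obtain ⟨x, hx⟩ := σ.surjective none
  cases x with
  | none => exact absurd hx h
  | some m => exact ⟨m, hx⟩

theorem perm_some_ne_none {σ : Equiv.Perm (Option ι)} (h : σ none = none) (i : ι) :
    σ (some i) ≠ none := fun hi => by
  simpa using σ.injective (hi.trans h.symm)

theorem perm_some_eq_none_iff {σ : Equiv.Perm (Option ι)} {m : ι} (h : σ (some m) = none) (i : ι) :
    σ (some i) = none ↔ i = m :=
  ⟨fun hi => by simpa using σ.injective (hi.trans h.symm), fun hi => hi ▸ h⟩

theorem perm_eq_of_removeNone_eq [DecidableEq ι] {σ τ : Equiv.Perm (Option ι)} (h : σ none = τ none)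
    (h' : Equiv.removeNone σ = Equiv.removeNone τ) : σ = τ :=
  Equiv.Perm.decomposeOption.injective (Prod.ext h h')

variable [Fintype ι]

/-- All edges of the flow, with multiplicity. -/
def edges (F : EdgeFlow ι E) : Multiset E :=
  ∑ i, (F.path i : Multiset E) + ∑ c ∈ F.cycles, c.toMultiset

def sign [DecidableEq ι] (F : EdgeFlow ι E) : ℤˣ :=
  Equiv.Perm.sign F.perm * (-1) ^ F.cycles.card

def weight {T : Type*} [CommRing T] (w : E → T) (F : EdgeFlow ι E) : T :=
  (F.edges.map w).prod

theorem mem_edges {F : EdgeFlow ι E} {e : E} :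
    e ∈ F.edges ↔ (∃ i, e ∈ F.path i) ∨ ∃ c ∈ F.cycles, e ∈ c := by
  simp [edges, Multiset.mem_sum, Cycle.mem_toMultiset]

theorem coe_cons_notMem_cycles {e : E} {l : List E} {F : EdgeFlow ι E} (he : e ∉ F.edges) :
    ((e :: l : List E) : Cycle E) ∉ F.cycles := fun hc =>
  he (mem_edges.2 (Or.inr ⟨_, hc, by simp⟩))

/-- `F` is a self-avoiding flow from `a` to `b` in the subgraph with edge set `S`. -/
structure IsFlow (S : Finset E) (a b : ι → V) (F : EdgeFlow ι E) : Prop where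
  isPath : ∀ i, G.IsPath (a i) (b (F.perm i)) (F.path i)
  isCycle : ∀ c ∈ F.cycles, c ≠ Cycle.nil ∧ c.Chain fun e f => G.head e = G.tail f
  nodup : ((Finset.univ : Finset ι).val.map a + F.edges.map G.head).Nodup
  subset : ∀ e ∈ F.edges, e ∈ S

variable [DecidableEq ι] [DecidableEq E]

/-- Glue the path ending at the tail of `e` to the path starting at the head of `e`; these are the
paths into the sink `none` and out of the source `none`.  If they coincide, a cycle arises. -/
def join (e : E) (F : EdgeFlow (Option ι) E) : EdgeFlow ι E where
  perm := Equiv.removeNone F.perm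
  path i := if F.perm (some i) = none then F.path (some i) ++ e :: F.path none else F.path (some i)
  cycles := if F.perm none = none then insert ((e :: F.path none : List E) : Cycle E) F.cycles
    else F.cycles

/-- The hypothesis excludes inserting a cycle already present, which would lose its edges, since the
cycles form a `Finset`. -/
theorem edges_join {e : E} {F : EdgeFlow (Option ι) E}
    (hF : F.perm none = none → ((e :: F.path none : List E) : Cycle E) ∉ F.cycles) :
    (F.join e).edges = e ::ₘ F.edges := by
  by_cases h : F.perm none = none
  · have hc := hF h
    simp [edges, join, h, perm_some_ne_none h, Finset.sum_insert hc, ← Multiset.cons_coe,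
      ← Multiset.singleton_add]
    abel
  · obtain ⟨m, hm⟩ := exists_perm_some_eq_none h
    have h1 : ∀ i, (((if F.perm (some i) = none then F.path (some i) ++ e :: F.path none
        else F.path (some i) : List E)) : Multiset E) =
        (F.path (some i) : Multiset E) +
          (if i = m then ((e :: F.path none : List E) : Multiset E) else 0) := by
      intro i
      by_cases hi : i = m <;> simp [perm_some_eq_none_iff hm, hi]
    simp only [edges, join, h, if_false, h1, Finset.sum_add_distrib, Finset.sum_ite_eq',
      Finset.mem_univ, if_true, Fintype.sum_option, ← Multiset.cons_coe, ← Multiset.singleton_add]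
    abel

/-- If `none` is fixed, the sign of the permutation is unchanged and one cycle is gained. Otherwise
the number of cycles is unchanged and the permutation loses the transposition of `none` and its
image. -/
theorem sign_join {e : E} {F : EdgeFlow (Option ι) E} (he : e ∉ F.edges) :
    (F.join e).sign = -F.sign := by
  have hs : Equiv.Perm.sign F.perm =
      Equiv.Perm.sign (Equiv.swap none (F.perm none)) * Equiv.Perm.sign (Equiv.removeNone F.perm) := by
    conv_lhs => rw [← Equiv.Perm.decomposeOption.symm_apply_apply F.perm]
    exact (Equiv.Perm.sign_mul _ _).trans (by rw [Equiv.optionCongr_sign]; rfl)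
  by_cases h : F.perm none = none
  · have hc := coe_cons_notMem_cycles (l := F.path none) he
    rw [sign, sign, hs]
    simp [join, h, hc, pow_succ]
  · rw [sign, sign, hs, Equiv.Perm.sign_swap (Ne.symm h)]
    simp [join, h]

variable {G} {S : Finset E} {e : E} {a b : ι → V}

theorem univ_option_val_map (a : Option ι → V) :
    (Finset.univ : Finset (Option ι)).val.map a =
      a none ::ₘ (Finset.univ : Finset ι).val.map fun i => a (some i) := by
  simp [Finset.univ, Fintype.elems, Finset.insertNone]

/-- Vertex-disjointness carries over unchanged: the head of `e` is counted first as a source and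
afterwards as the head of an edge. -/
theorem IsFlow.join (he : e ∉ S) {F : EdgeFlow (Option ι) E}
    (hF : F.IsFlow G S (fun i => i.elim (G.head e) a) (fun i => i.elim (G.tail e) b)) :
    (F.join e).IsFlow G (insert e S) a b := by
  have heF : e ∉ F.edges := fun h => he (hF.subset e h)
  refine ⟨fun i => ?_, fun c hc => ?_, ?_, fun f hf => ?_⟩
  · have hi := hF.isPath (some i)
    have hn := hF.isPath none
    by_cases h : F.perm (some i) = none
    · have := Equiv.removeNone_none F.perm h
      rw [← this] at hn
      rw [h] at hi
      simpa [EdgeFlow.join, h] using IsPath.append_cons_iff.2 ⟨hi, hn⟩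
    · have := Equiv.removeNone_some F.perm (Option.ne_none_iff_exists'.1 h)
      rw [← this] at hi
      simpa [EdgeFlow.join, h] using hi
  · by_cases h : F.perm none = none
    · rw [EdgeFlow.join] at hc
      simp only [h, if_true, Finset.mem_insert] at hc
      rcases hc with rfl | hc
      · refine ⟨by simp, ?_⟩
        rw [Cycle.chain_coe_cons, IsPath.isChain_iff]
        simpa [h] using hF.isPath none
      · exact hF.isCycle c hc
    · exact hF.isCycle c (by simpa [EdgeFlow.join, h] using hc)
  · have := hF.nodup
    rw [univ_option_val_map] at this
    rw [edges_join fun _ => coe_cons_notMem_cycles heF, Multiset.map_cons, Multiset.add_cons]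
    simpa using this
  · rw [edges_join fun _ => coe_cons_notMem_cycles heF, Multiset.mem_cons] at hf
    rcases hf with rfl | hf
    · exact Finset.mem_insert_self _ _
    · exact Finset.mem_insert_of_mem (hF.subset f hf)

theorem IsFlow.of_join {F : EdgeFlow (Option ι) E}
    (hc : F.perm none = none → ((e :: F.path none : List E) : Cycle E) ∉ F.cycles)
    (h : (F.join e).IsFlow G (insert e S) a b) :
    F.IsFlow G S (fun i => i.elim (G.head e) a) (fun i => i.elim (G.tail e) b) := by
  have hedges := edges_join hc
  have hnodup := h.nodup
  rw [hedges, Multiset.map_cons, Multiset.add_cons] at hnodup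
  have he : e ∉ F.edges := fun he => (Multiset.nodup_cons.1 hnodup).1
    (Multiset.mem_add.2 (Or.inr (Multiset.mem_map_of_mem _ he)))
  refine ⟨fun i => ?_, fun c hc => h.isCycle c ?_, ?_, fun f hf => ?_⟩
  · cases i with
    | none =>
      by_cases hn : F.perm none = none
      · have := (h.isCycle ((e :: F.path none : List E) : Cycle E) (by simp [EdgeFlow.join, hn])).2
        rw [Cycle.chain_coe_cons, IsPath.isChain_iff] at this
        simpa [hn] using this
      · obtain ⟨m, hm⟩ := exists_perm_some_eq_none hn
        have := h.isPath m
        simp only [EdgeFlow.join, hm, if_true] at this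
        rw [← Equiv.removeNone_none F.perm hm]
        exact (IsPath.append_cons_iff.1 this).2
    | some i =>
      have := h.isPath i
      by_cases hi : F.perm (some i) = none
      · simp only [EdgeFlow.join, hi, if_true] at this
        rw [hi]
        exact (IsPath.append_cons_iff.1 this).1
      · simp only [EdgeFlow.join, hi, if_false] at this
        rw [← Equiv.removeNone_some F.perm (Option.ne_none_iff_exists'.1 hi)]
        exact this
  · unfold EdgeFlow.join
    dsimp only
    split_ifs
    · exact Finset.mem_insert_of_mem hc
    · exact hc
  · rw [univ_option_val_map]
    simpa using hnodup
  · refine Finset.mem_of_mem_insert_of_ne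
      (h.subset f (hedges ▸ Multiset.mem_cons_of_mem hf)) ?_
    rintro rfl
    exact he hf

/-- The single occurrence of `e` in the joined flow shows where to cut. It lies on a cycle exactly
when `none` was fixed; otherwise the path containing it is the one that ended at the sink `none`. -/
theorem join_injective {F F' : EdgeFlow (Option ι) E} (he : e ∉ F.edges) (he' : e ∉ F'.edges)
    (h : F.join e = F'.join e) : F = F' := by
  have hpath : ∀ i, e ∉ F.path i := fun i hi => he (mem_edges.2 (Or.inl ⟨i, hi⟩))
  have hpath' : ∀ i, e ∉ F'.path i := fun i hi => he' (mem_edges.2 (Or.inl ⟨i, hi⟩))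
  have hcyc : ∀ c ∈ F.cycles, e ∉ c := fun c hc hi => he (mem_edges.2 (Or.inr ⟨c, hc, hi⟩))
  have hcyc' : ∀ c ∈ F'.cycles, e ∉ c := fun c hc hi => he' (mem_edges.2 (Or.inr ⟨c, hc, hi⟩))
  have hp : Equiv.removeNone F.perm = Equiv.removeNone F'.perm := congrArg EdgeFlow.perm h
  have hl := fun i => congrFun (congrArg EdgeFlow.path h) i
  have hc : (F.join e).cycles = (F'.join e).cycles := congrArg EdgeFlow.cycles h
  have hnn : F.perm none = none ↔ F'.perm none = none := by
    have key : ∀ F : EdgeFlow (Option ι) E, (∀ c ∈ F.cycles, e ∉ c) →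
        (F.perm none = none ↔ ∃ c ∈ (F.join e).cycles, e ∈ c) := by
      intro F hF
      by_cases h : F.perm none = none
      · simp [EdgeFlow.join, h]
      · simpa [EdgeFlow.join, h] using hF
    rw [key F hcyc, key F' hcyc', hc]
  by_cases hn : F.perm none = none
  · have hn' := hnn.1 hn
    have hperm := perm_eq_of_removeNone_eq (hn.trans hn'.symm) hp
    simp only [EdgeFlow.join, hn, hn', if_true] at hc
    have hcc : ((e :: F.path none : List E) : Cycle E) = (e :: F'.path none : List E) := by
      have := hc ▸ Finset.mem_insert_self ((e :: F.path none : List E) : Cycle E) F.cycles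
      rcases Finset.mem_insert.1 this with h | h
      · exact h
      · exact absurd (by simp) (hcyc' _ h)
    have hnone := (Cycle.coe_cons_inj_of_notMem (hpath' none)).1 hcc
    refine EdgeFlow.ext hperm (funext fun i => ?_) ?_
    · cases i with
      | none => exact hnone
      | some i => simpa [EdgeFlow.join, perm_some_ne_none hn, perm_some_ne_none hn'] using hl i
    · rw [← hcc] at hc
      have h1 : ((e :: F.path none : List E) : Cycle E) ∉ F.cycles := fun h => hcyc _ h (by simp)
      have h2 : ((e :: F.path none : List E) : Cycle E) ∉ F'.cycles := fun h => hcyc' _ h (by simp)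
      rw [← Finset.erase_insert h1, hc, Finset.erase_insert h2]
  · have hn' : ¬F'.perm none = none := fun h => hn (hnn.2 h)
    obtain ⟨m, hm⟩ := exists_perm_some_eq_none hn
    have hm' : F'.perm (some m) = none := by
      by_contra hm'
      have h1 := hl m
      simp only [EdgeFlow.join, hm, hm', if_true, if_false] at h1
      exact hpath' (some m) (h1 ▸ by simp)
    have hperm : F.perm = F'.perm := by
      refine perm_eq_of_removeNone_eq ?_ hp
      rw [← Equiv.removeNone_none F.perm hm, ← Equiv.removeNone_none F'.perm hm', hp]
    have hlm := hl m
    simp only [EdgeFlow.join, hm, hm', if_true] at hlm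
    rw [List.append_cons_inj_of_notMem (hpath _) (hpath _)] at hlm
    refine EdgeFlow.ext hperm (funext fun i => ?_) (by simpa [EdgeFlow.join, hn, hn'] using hc)
    cases i with
    | none => exact hlm.2.2
    | some i =>
      by_cases him : i = m
      · exact him ▸ hlm.1
      · have h1 : F.perm (some i) ≠ none := fun h => him ((perm_some_eq_none_iff hm i).1 h)
        have h2 : F'.perm (some i) ≠ none := fun h => him ((perm_some_eq_none_iff hm' i).1 h)
        simpa [EdgeFlow.join, h1, h2] using hl i

/-- Removing `e` from a cycle or a path of the flow. -/
theorem exists_join_eq {F : EdgeFlow ι E} (he : e ∈ F.edges) :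
    ∃ F' : EdgeFlow (Option ι) E, F'.join e = F ∧
      (F'.perm none = none → ((e :: F'.path none : List E) : Cycle E) ∉ F'.cycles) := by
  rcases mem_edges.1 he with ⟨m, hm⟩ | ⟨c, hc, hec⟩
  · obtain ⟨l₁, l₂, hl⟩ := List.append_of_mem hm
    -- The second half of the cut path, starting at `none`, inherits the old sink; the first half,
    -- starting at `some m`, goes to the sink `none`.
    let σ := Equiv.Perm.decomposeOption.symm (some (F.perm m), F.perm)
    have hσ : (σ none, Equiv.removeNone σ) = (some (F.perm m), F.perm) :=
      Equiv.Perm.decomposeOption.apply_symm_apply (some (F.perm m), F.perm)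
    have hσ₁ : σ none = some (F.perm m) := congrArg Prod.fst hσ
    have hσ₂ : Equiv.removeNone σ = F.perm := congrArg Prod.snd hσ
    have hσ₃ : σ (some m) = none := by
      simp [σ]
    refine ⟨⟨σ, fun i => i.elim l₂ (Function.update F.path m l₁), F.cycles⟩,
      EdgeFlow.ext hσ₂ (funext fun i => ?_) ?_, fun h => ?_⟩
    · by_cases him : i = m
      · subst him
        simp [EdgeFlow.join, hσ₃, hl]
      · simp [EdgeFlow.join, perm_some_eq_none_iff hσ₃, him]
    · simp [EdgeFlow.join, hσ₁]
    · simp [hσ₁] at h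
  · obtain ⟨l, rfl⟩ := Cycle.exists_eq_coe_cons hec
    let σ := Equiv.Perm.decomposeOption.symm (none, F.perm)
    have hσ : (σ none, Equiv.removeNone σ) = (none, F.perm) :=
      Equiv.Perm.decomposeOption.apply_symm_apply (none, F.perm)
    have hσ₁ : σ none = none := congrArg Prod.fst hσ
    have hσ₂ : Equiv.removeNone σ = F.perm := congrArg Prod.snd hσ
    refine ⟨⟨σ, fun i => i.elim l F.path, F.cycles.erase (e :: l : List E)⟩,
      EdgeFlow.ext hσ₂ (funext fun i => ?_) ?_, fun _ => Finset.notMem_erase _ _⟩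
    · simp [EdgeFlow.join, perm_some_ne_none hσ₁]
    · simp [EdgeFlow.join, hσ₁, Finset.insert_erase hc]

end EdgeFlow

end DirectedGraph

/-! ### The path matrix -/

namespace DirectedGraph

variable {V E : Type*} (G : DirectedGraph V E) (R : Type*) [CommRing R]

theorem Path.coe_weight {u v : V} (P : G.Path u v) :
    (P.weight R : MvPowerSeries E R) = (P.edges.map MvPowerSeries.X).prod := by
  unfold Path.weight
  induction P.edges with
  | nil => simp
  | cons e l ih => simp [ih]

-- Summing over all lists with an indicator, instead of over a type depending on the endpoints,
-- allows splitting off the first edge.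
open Classical in
theorem coeff_pathMatrix (u v : V) (d : E →₀ ℕ) :
    MvPowerSeries.coeff d (G.pathMatrix R u v) =
      ∑ᶠ l : List E, if G.IsPath u v l then
        MvPowerSeries.coeff d (l.map (MvPowerSeries.X (R := R))).prod else 0 := by
  have h : MvPowerSeries.coeff d (G.pathMatrix R u v) = ∑ᶠ P : G.Path u v,
      MvPowerSeries.coeff d (P.weight R : MvPowerSeries E R) := rfl
  rw [h, ← finsum_mem_univ]
  have h2 : ∀ f : List E → R, ∑ᶠ l : List E, (if G.IsPath u v l then f l else 0) =
      ∑ᶠ l ∈ {l | G.IsPath u v l}, f l := fun f => by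
    refine finsum_congr fun l => ?_
    rw [finsum_eq_if]
    rfl
  rw [h2]
  refine finsum_mem_eq_of_bijOn Path.edges ⟨fun P _ => P.isPath, fun P _ Q _ h => Path.ext h,
    fun l hl => ⟨⟨l, hl⟩, trivial, rfl⟩⟩ fun P _ => ?_
  rw [Path.coe_weight]

open Classical in
theorem finite_support_path_coeff [Finite E] (u v : V) (d : E →₀ ℕ) :
    (Function.support fun l : List E => if G.IsPath u v l then
        MvPowerSeries.coeff d (l.map (MvPowerSeries.X (R := R))).prod else 0).Finite := by
  refine ((G.finite_path_coeff_ne_zero R u v d).image Path.edges).subset fun l hl => ?_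
  have hl' : G.IsPath u v l := by
    by_contra h
    simp [h] at hl
  refine ⟨⟨l, hl'⟩, ?_, rfl⟩
  simpa [Path.coe_weight, hl'] using hl

/-- A finitely supported sum over lists, split according to the first element. -/
theorem _root_.List.finsum_eq_nil_add_sum_cons {E M : Type*} [Fintype E] [AddCommMonoid M]
    (f : List E → M) (hf : f.support.Finite) :
    ∑ᶠ l, f l = f [] + ∑ e, ∑ᶠ l, f (e :: l) := by
  classical
  have hsplit : ∀ l, f l = Set.indicator {[]} f l +
      ∑ e, Set.indicator (Set.range (List.cons e)) f l := fun l => by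
    cases l <;> simp [Set.indicator_apply]
  have hfin : ∀ s : Set (List E), (Function.support (Set.indicator s f)).Finite := fun s =>
    hf.subset (by simp)
  rw [finsum_congr hsplit, finsum_add_distrib (hfin _), finsum_sum_comm _ _ fun e _ => hfin _,
    ← finsum_mem_def, finsum_mem_singleton]
  · congr 1
    refine Finset.sum_congr rfl fun e _ => ?_
    rw [← finsum_mem_def, finsum_mem_range (List.cons_injective)]
  · refine (Set.finite_iUnion fun e => hfin (Set.range (List.cons e))).subset fun l hl => ?_
    obtain ⟨e, _, he⟩ := Finset.exists_ne_zero_of_sum_ne_zero hl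
    exact Set.mem_iUnion.2 ⟨e, he⟩

/-- A path is trivial or a first edge followed by a path, so `M = 1 + A * M`, checked coefficient by
coefficient. -/
theorem one_sub_adjacencyMatrix_mul_pathMatrix [Fintype V] [DecidableEq V] [Fintype E] :
    (1 - G.adjacencyMatrix R) * G.pathMatrix R = 1 := by
  classical
  have key : G.pathMatrix R = 1 + G.adjacencyMatrix R * G.pathMatrix R := by
    ext u v d
    have hmul : (G.adjacencyMatrix R * G.pathMatrix R) u v =
        ∑ e : E, if G.tail e = u then MvPowerSeries.X e * G.pathMatrix R (G.head e) v else 0 := by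
      simp only [Matrix.mul_apply, adjacencyMatrix, Matrix.of_apply, Finset.sum_mul,
        Finset.sum_filter]
      rw [Finset.sum_comm]
      refine Finset.sum_congr rfl fun e _ => ?_
      by_cases h : G.tail e = u <;> simp [h, ite_mul]
    rw [coeff_pathMatrix, List.finsum_eq_nil_add_sum_cons _
      (G.finite_support_path_coeff R u v d), Matrix.add_apply, hmul, map_add, map_sum]
    congr 1
    · by_cases h : u = v <;> simp [IsPath, h, Matrix.one_apply]
    · refine Finset.sum_congr rfl fun e _ => ?_
      by_cases h : G.tail e = u
      · have hX : ∀ f : MvPowerSeries E R, MvPowerSeries.coeff d (MvPowerSeries.X e * f) =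
            if Finsupp.single e 1 ≤ d then MvPowerSeries.coeff (d - Finsupp.single e 1) f else 0 := by
          intro f
          rw [MvPowerSeries.X_def, MvPowerSeries.coeff_monomial_mul]
          simp
        simp only [IsPath, h, true_and, List.map_cons, List.prod_cons, hX, if_true,
          coeff_pathMatrix]
        split_ifs with hd
        · rfl
        · simp
      · simp [IsPath, h]
  rw [sub_mul, one_mul]
  exact sub_eq_iff_eq_add.2 key

end DirectedGraph

/-! ### The signed sum over all flows as a determinant -/

namespace DirectedGraph

variable {V E : Type*} (G : DirectedGraph V E)

namespace EdgeFlow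

variable {G} {ι : Type} [Fintype ι]

theorem isFlow_empty_iff {a b : ι → V} {F : EdgeFlow ι E} :
    F.IsFlow G ∅ a b ↔ Function.Injective a ∧ (∀ i, a i = b (F.perm i)) ∧
      F = ⟨F.perm, fun _ => [], ∅⟩ := by
  constructor
  · intro h
    have hl : ∀ i, F.path i = [] := fun i => List.eq_nil_iff_forall_not_mem.2 fun e he =>
      absurd (h.subset e (mem_edges.2 (Or.inl ⟨i, he⟩))) (Finset.notMem_empty e)
    refine ⟨?_, fun i => ?_, EdgeFlow.ext rfl (funext hl) ?_⟩
    · have := (Multiset.nodup_add.1 h.nodup).1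
      intro i j hij
      exact Multiset.inj_on_of_nodup_map this i (Finset.mem_univ i) j (Finset.mem_univ j) hij
    · simpa [hl, IsPath] using h.isPath i
    · refine Finset.eq_empty_of_forall_notMem fun c hc => ?_
      refine (h.isCycle c hc).1 (Cycle.toMultiset_eq_nil.1 ?_)
      refine Multiset.eq_zero_of_forall_notMem fun e he => ?_
      exact absurd (h.subset e (mem_edges.2 (Or.inr ⟨c, hc, Cycle.mem_toMultiset.1 he⟩)))
        (Finset.notMem_empty e)
  · rintro ⟨ha, hab, hF⟩
    have h0 : F.edges = 0 := by
      rw [hF]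
      simp [edges]
    refine ⟨fun i => ?_, fun c hc => ?_, ?_, fun e he => ?_⟩
    · rw [hF]
      exact hab i
    · rw [hF] at hc
      exact absurd hc (Finset.notMem_empty c)
    · rw [h0, Multiset.map_zero, add_zero]
      exact Finset.univ.nodup.map ha
    · rw [h0] at he
      exact absurd he (Multiset.notMem_zero e)

theorem bijOn_isFlow_empty {a b : ι → V} (ha : Function.Injective a) :
    Set.BijOn (fun σ : Equiv.Perm ι => (⟨σ, fun _ => [], ∅⟩ : EdgeFlow ι E))
      {σ | ∀ i, a i = b (σ i)} {F | F.IsFlow G ∅ a b} := by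
  refine ⟨fun σ hσ => isFlow_empty_iff.2 ⟨ha, hσ, rfl⟩, fun σ _ τ _ h => congrArg EdgeFlow.perm h,
    fun F hF => ?_⟩
  obtain ⟨-, h1, h2⟩ := isFlow_empty_iff.1 hF
  exact ⟨F.perm, h1, h2.symm⟩

variable [DecidableEq ι]

theorem isFlow_insert_eq_union [DecidableEq E] {S : Finset E} {e : E} (he : e ∉ S) (a b : ι → V) :
    {F : EdgeFlow ι E | F.IsFlow G (insert e S) a b} = {F | F.IsFlow G S a b} ∪
      join e '' {F | F.IsFlow G S (fun i => i.elim (G.head e) a)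
        (fun i => i.elim (G.tail e) b)} := by
  ext F
  constructor
  · intro h
    by_cases heF : e ∈ F.edges
    · obtain ⟨F', rfl, hF'⟩ := exists_join_eq heF
      exact Or.inr ⟨F', h.of_join hF', rfl⟩
    · refine Or.inl ⟨h.isPath, h.isCycle, h.nodup, fun f hf => ?_⟩
      refine Finset.mem_of_mem_insert_of_ne (h.subset f hf) ?_
      rintro rfl
      exact heF hf
  · rintro (h | ⟨F', h, rfl⟩)
    · exact ⟨h.isPath, h.isCycle, h.nodup, fun f hf => Finset.mem_insert_of_mem (h.subset f hf)⟩
    · exact h.join he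

-- The index type and the endpoints are quantified inside the induction, since each edge adds a
-- source and a sink. Injectivity cannot be assumed, as the new endpoints may coincide with old
-- ones.
variable (G) in
theorem finite_and_finsum_eq_det [Fintype V] [DecidableEq V] {T : Type*} [CommRing T] (w : E → T)
    (S : Finset E) : ∀ {ι : Type} [Fintype ι] [DecidableEq ι] (a b : ι → V),
      {F : EdgeFlow ι E | F.IsFlow G S a b}.Finite ∧
        ∑ᶠ F ∈ {F : EdgeFlow ι E | F.IsFlow G S a b}, F.sign • F.weight w =
          (G.borderedMatrix w S a b).det := by
  classical
  induction S using Finset.induction_on with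
  | empty =>
    intro ι _ _ a b
    rw [det_borderedMatrix_empty]
    by_cases ha : Function.Injective a
    · have hbij := bijOn_isFlow_empty (G := G) (b := b) ha
      refine ⟨hbij.image_eq ▸ (Set.toFinite _).image _, ?_⟩
      rw [← finsum_mem_eq_of_bijOn (f := fun σ : Equiv.Perm ι =>
        Equiv.Perm.sign σ • (1 : T)) _ hbij fun σ _ => by simp [sign, weight, edges],
        ← Matrix.det_transpose, Matrix.det_apply, finsum_mem_eq_finite_toFinset_sum _ (Set.toFinite _)]
      rw [← Finset.sum_subset (Finset.subset_univ (Set.toFinite {σ | ∀ i, a i = b (σ i)}).toFinset)]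
      · refine Finset.sum_congr rfl fun σ hσ => ?_
        have hσ : ∀ i, a i = b (σ i) := by simpa using hσ
        simp [hσ, Matrix.one_apply]
      · intro σ _ hσ
        have hσ : ∃ i, a i ≠ b (σ i) := by simpa using hσ
        obtain ⟨i, hi⟩ := hσ
        rw [Finset.prod_eq_zero (Finset.mem_univ i) (by simp [hi]), smul_zero]
    -- A repeated source excludes every flow and gives two equal rows.
    · have hempty : {F : EdgeFlow ι E | F.IsFlow G ∅ a b} = ∅ :=
        Set.eq_empty_of_forall_notMem fun F hF => ha (isFlow_empty_iff.1 hF).1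
      rw [hempty, finsum_mem_empty]
      refine ⟨Set.finite_empty, ?_⟩
      obtain ⟨i, j, hij, hne⟩ := Function.not_injective_iff.1 ha
      exact (Matrix.det_zero_of_row_eq hne (by ext k; simp [hij, Matrix.one_apply])).symm
  | insert e S he ih =>
    intro ι _ _ a b
    obtain ⟨h1, h2⟩ := ih a b
    obtain ⟨h3, h4⟩ := ih (fun i : Option ι => i.elim (G.head e) a) (fun i => i.elim (G.tail e) b)
    have hnot : ∀ {ι : Type} [Fintype ι] {a b : ι → V} {F : EdgeFlow ι E},
        F.IsFlow G S a b → e ∉ F.edges := fun h hF => he (h.subset e hF)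
    have hinj : Set.InjOn (join e) {F | F.IsFlow G S (fun i : Option ι => i.elim (G.head e) a)
        (fun i => i.elim (G.tail e) b)} := fun F hF F' hF' h =>
      join_injective (hnot hF) (hnot hF') h
    have hdisj : Disjoint {F : EdgeFlow ι E | F.IsFlow G S a b}
        (join e '' {F | F.IsFlow G S (fun i => i.elim (G.head e) a)
          (fun i => i.elim (G.tail e) b)}) := by
      rw [Set.disjoint_right]
      rintro _ ⟨F, hF, rfl⟩ h
      refine hnot h ?_
      rw [edges_join fun _ => coe_cons_notMem_cycles (hnot hF)]
      exact Multiset.mem_cons_self _ _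
    rw [isFlow_insert_eq_union he]
    refine ⟨h1.union (h3.image _), ?_⟩
    rw [finsum_mem_union hdisj h1 (h3.image _), h2, det_borderedMatrix_insert G w he,
      finsum_mem_image hinj, sub_eq_add_neg,
      ← neg_mul, ← h4, ← AddMonoidHom.coe_mulLeft, AddMonoidHom.map_finsum_mem _ _ h3]
    congr 1
    refine finsum_mem_congr rfl fun F hF => ?_
    rw [sign_join (hnot hF), weight, edges_join fun _ => coe_cons_notMem_cycles (hnot hF),
      Multiset.map_cons, Multiset.prod_cons, weight, Units.neg_smul, AddMonoidHom.coe_mulLeft,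
      neg_mul, mul_smul_comm]

end EdgeFlow

end DirectedGraph

/-! ### Self-avoiding flows -/

namespace DirectedGraph

variable {V E : Type*} {G : DirectedGraph V E}

theorem _root_.Multiset.nodup_finset_sum {ι α : Type*} {s : Finset ι} {f : ι → Multiset α} :
    (∑ i ∈ s, f i).Nodup ↔ (∀ i ∈ s, (f i).Nodup) ∧ (s : Set ι).PairwiseDisjoint f := by
  classical
  induction s using Finset.induction_on with
  | empty => simp
  | insert i s hi ih =>
    have hdisj : Disjoint (f i) (∑ j ∈ s, f j) ↔ ∀ j ∈ s, Disjoint (f i) (f j) := by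
      simp only [Multiset.disjoint_left, Multiset.mem_sum]
      grind
    rw [Finset.sum_insert hi, Multiset.nodup_add, ih, hdisj, Finset.coe_insert,
      Set.pairwiseDisjoint_insert_of_notMem (by simpa using hi), Finset.forall_mem_insert]
    simp only [Finset.mem_coe]
    tauto

theorem _root_.Cycle.mem_map_iff_mem_toMultiset {c : Cycle E} {f : E → V} {v : V} :
    v ∈ c.map f ↔ v ∈ c.toMultiset.map f := by
  induction c using Quotient.inductionOn' with
  | h l => rfl

theorem _root_.Cycle.nodup_map_iff_nodup_toMultiset {c : Cycle E} {f : E → V} :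
    (c.map f).Nodup ↔ (c.toMultiset.map f).Nodup := by
  induction c using Quotient.inductionOn' with
  | h l => rfl

theorem _root_.Multiset.disjoint_iff_disjoint_setOf_mem {α : Type*} {s t : Multiset α} :
    Disjoint s t ↔ Disjoint {x | x ∈ s} {x | x ∈ t} := by
  rw [Multiset.disjoint_left, Set.disjoint_left]
  rfl

/-- A path visits its source and the heads of its edges, and a cycle visits its heads, which are its
tails. So the single `Nodup` condition encodes self-avoidance and all disjointness conditions at
once. -/
theorem EdgeFlow.nodup_vertices_iff {ι : Type} [Fintype ι] {a : ι → V}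
    {F : EdgeFlow ι E}
    (hF : ∀ c ∈ F.cycles, c.Chain fun e f => G.head e = G.tail f) :
    ((Finset.univ : Finset ι).val.map a + F.edges.map G.head).Nodup ↔
      ((∀ i, (a i :: (F.path i).map G.head).Nodup) ∧ ∀ i j, i ≠ j →
        Disjoint {v | v ∈ a i :: (F.path i).map G.head} {v | v ∈ a j :: (F.path j).map G.head}) ∧
      ((∀ c ∈ F.cycles, (c.map G.tail).Nodup) ∧ (F.cycles : Set (Cycle E)).PairwiseDisjoint
        fun c => {v | v ∈ c.map G.tail}) ∧
      ∀ i, ∀ c ∈ F.cycles, Disjoint {v | v ∈ a i :: (F.path i).map G.head}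
        {v | v ∈ c.map G.tail} := by
  have h1 : (Finset.univ : Finset ι).val.map a + F.edges.map G.head =
      ∑ i, ((a i :: (F.path i).map G.head : List V) : Multiset V) +
        ∑ c ∈ F.cycles, c.toMultiset.map G.tail := by
    have h2 : (Finset.univ : Finset ι).val.map a = ∑ i, {a i} := by
      rw [← Finset.sum_multiset_singleton Finset.univ, ← Multiset.coe_mapAddMonoidHom, map_sum]
      simp
    rw [EdgeFlow.edges, Multiset.map_add, h2, ← add_assoc, ← Multiset.coe_mapAddMonoidHom, map_sum,
      map_sum, ← Finset.sum_add_distrib]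
    congr 1
    exact Finset.sum_congr rfl fun c hc => map_head_eq_map_tail G (hF c hc)
  have h3 : Disjoint (∑ i, ((a i :: (F.path i).map G.head : List V) : Multiset V))
      (∑ c ∈ F.cycles, c.toMultiset.map G.tail) ↔ ∀ i, ∀ c ∈ F.cycles,
        Disjoint ((a i :: (F.path i).map G.head : List V) : Multiset V)
          (c.toMultiset.map G.tail) := by
    simp only [Multiset.disjoint_left, Multiset.mem_sum]
    grind
  rw [h1, Multiset.nodup_add, h3, Multiset.nodup_finset_sum, Multiset.nodup_finset_sum]
  simp only [Cycle.mem_map_iff_mem_toMultiset, Cycle.nodup_map_iff_nodup_toMultiset,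
    Set.PairwiseDisjoint, Set.Pairwise, Function.onFun, Multiset.disjoint_iff_disjoint_setOf_mem,
    Finset.mem_univ, Finset.coe_univ, Set.mem_univ, true_imp_iff, Multiset.coe_nodup,
    Multiset.mem_coe]

namespace SelfAvoidingFlow

variable {k : ℕ} {a b : Fin k → V}

/-- The lists of edges underlying a self-avoiding flow. -/
def toEdgeFlow (F : G.SelfAvoidingFlow a b) : EdgeFlow (Fin k) E where
  perm := F.paths.perm
  path i := (F.paths.path i).edges
  cycles := F.cycles.cycles.map ⟨SelfAvoidingCycle.edges, fun _ _ h => SelfAvoidingCycle.ext h⟩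

theorem toEdgeFlow_injective :
    Function.Injective (toEdgeFlow : G.SelfAvoidingFlow a b → EdgeFlow (Fin k) E) := by
  rintro ⟨⟨π, P⟩, C, h₁, h₂, h₃⟩ ⟨⟨π', P'⟩, C', h₁', h₂', h₃'⟩ h
  simp only [toEdgeFlow, EdgeFlow.mk.injEq, Finset.map_inj] at h
  obtain ⟨rfl, hP, hC⟩ := h
  obtain rfl : P = P' := funext fun i => Path.ext (congrFun hP i)
  obtain rfl : C = C' := CycleCollection.ext hC
  rfl

theorem isFlow_toEdgeFlow [Fintype E] (F : G.SelfAvoidingFlow a b) :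
    F.toEdgeFlow.IsFlow G Finset.univ a b := by
  have hcyc : ∀ c ∈ F.toEdgeFlow.cycles, ∃ d ∈ F.cycles.cycles, d.edges = c := fun c hc =>
    Finset.mem_map.1 hc
  refine ⟨fun i => (F.paths.path i).isPath, fun c hc => ?_, ?_, fun e _ => Finset.mem_univ e⟩
  · obtain ⟨d, -, rfl⟩ := hcyc c hc
    exact ⟨d.ne_nil, d.chain⟩
  · rw [EdgeFlow.nodup_vertices_iff]
    · refine ⟨⟨F.selfAvoiding, F.paths_disjoint⟩, ⟨fun c hc => ?_, fun c hc c' hc' hne => ?_⟩,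
        fun i c hc => ?_⟩
      · obtain ⟨d, -, rfl⟩ := hcyc c hc
        exact d.nodup
      · obtain ⟨d, hd, rfl⟩ := hcyc c hc
        obtain ⟨d', hd', rfl⟩ := hcyc c' hc'
        exact F.cycles.disjoint hd hd' fun h => hne (h ▸ rfl)
      · obtain ⟨d, hd, rfl⟩ := hcyc c hc
        exact F.paths_cycles_disjoint i d hd
    · intro c hc
      obtain ⟨d, -, rfl⟩ := hcyc c hc
      exact d.chain

theorem exists_toEdgeFlow_eq {S : Finset E} {F : EdgeFlow (Fin k) E} (hF : F.IsFlow G S a b) :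
    ∃ F' : G.SelfAvoidingFlow a b, F'.toEdgeFlow = F := by
  obtain ⟨⟨h₁, h₂⟩, ⟨h₃, h₄⟩, h₅⟩ :=
    (EdgeFlow.nodup_vertices_iff fun c hc => (hF.isCycle c hc).2).1 hF.nodup
  let lift : {c // c ∈ F.cycles} ↪ G.SelfAvoidingCycle :=
    ⟨fun c => ⟨c, (hF.isCycle c c.2).1, (hF.isCycle c c.2).2, h₃ c c.2⟩,
      fun c c' h => Subtype.ext (congrArg SelfAvoidingCycle.edges h)⟩
  have hlift : ∀ d ∈ F.cycles.attach.map lift, ∃ c : {c // c ∈ F.cycles}, d = lift c := by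
    intro d hd
    obtain ⟨c, -, rfl⟩ := Finset.mem_map.1 hd
    exact ⟨c, rfl⟩
  refine ⟨⟨⟨F.perm, fun i => ⟨F.path i, hF.isPath i⟩⟩, ⟨F.cycles.attach.map lift, ?_⟩, h₁, h₂, ?_⟩,
    EdgeFlow.ext rfl rfl ?_⟩
  · intro d hd d' hd' hne
    obtain ⟨c, rfl⟩ := hlift d hd
    obtain ⟨c', rfl⟩ := hlift d' hd'
    exact h₄ c.2 c'.2 fun h => hne (congrArg lift (Subtype.ext h))
  · intro i d hd
    obtain ⟨c, rfl⟩ := hlift d hd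
    exact h₅ i c c.2
  · rw [toEdgeFlow, Finset.map_map]
    exact Finset.attach_map_val

theorem sign_toEdgeFlow (F : G.SelfAvoidingFlow a b) : F.toEdgeFlow.sign = F.sign := by
  simp [EdgeFlow.sign, sign, toEdgeFlow, PathCollection.sign, CycleCollection.sign]

theorem weight_toEdgeFlow (R : Type*) [CommRing R] (F : G.SelfAvoidingFlow a b) :
    F.toEdgeFlow.weight MvPolynomial.X = F.weight R := by
  rw [EdgeFlow.weight, EdgeFlow.edges, Multiset.map_add, Multiset.prod_add,
    ← Multiset.coe_mapAddMonoidHom, map_sum, map_sum]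
  simp [toEdgeFlow, weight, PathCollection.weight, CycleCollection.weight, Path.weight,
    SelfAvoidingCycle.weight, Multiset.prod_sum]
  rfl

end SelfAvoidingFlow

/-! ### The determinant formulas and the quotient -/

variable (G) (R : Type*) [CommRing R]

theorem flowPolynomial_eq_det [Fintype V] [DecidableEq V] [Fintype E] {k : ℕ} (a b : Fin k → V) :
    G.flowPolynomial R a b =
      (G.borderedMatrix (MvPolynomial.X (R := R)) Finset.univ a b).det := by
  rw [← (EdgeFlow.finite_and_finsum_eq_det G (MvPolynomial.X (R := R)) Finset.univ a b).2,
    flowPolynomial, ← finsum_eq_sum_of_fintype, ← finsum_mem_univ]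
  refine finsum_mem_eq_of_bijOn SelfAvoidingFlow.toEdgeFlow ⟨fun F _ => F.isFlow_toEdgeFlow,
    SelfAvoidingFlow.toEdgeFlow_injective.injOn, fun F hF => ?_⟩ fun F _ => ?_
  · obtain ⟨F', rfl⟩ := SelfAvoidingFlow.exists_toEdgeFlow_eq hF
    exact ⟨F', trivial, rfl⟩
  · rw [SelfAvoidingFlow.sign_toEdgeFlow, SelfAvoidingFlow.weight_toEdgeFlow]

/-- With no sources only the cycles remain, so the denominator is the case `k = 0` of the numerator.
-/
theorem cyclePolynomial_eq_flowPolynomial [Finite E] (a b : Fin 0 → V) :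
    G.cyclePolynomial R = G.flowPolynomial R a b := by
  refine (Fintype.sum_bijective SelfAvoidingFlow.cycles ⟨?_, fun C => ?_⟩ _ _ fun F => ?_).symm
  · intro F F' h
    refine SelfAvoidingFlow.toEdgeFlow_injective (EdgeFlow.ext (Subsingleton.elim _ _)
      (Subsingleton.elim _ _) ?_)
    simp only [SelfAvoidingFlow.toEdgeFlow, h]
  · exact ⟨⟨⟨1, fun i => i.elim0⟩, C, fun i => i.elim0, fun i => i.elim0, fun i => i.elim0⟩, rfl⟩
  · simp [SelfAvoidingFlow.sign, SelfAvoidingFlow.weight, PathCollection.sign,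
      PathCollection.weight, Subsingleton.elim F.paths.perm 1]

theorem adjacencyMatrix_eq_partialAdjacency [Fintype V] [DecidableEq V] [Fintype E] :
    G.adjacencyMatrix R = G.partialAdjacency (MvPowerSeries.X (R := R)) Finset.univ := by
  classical
  ext1 u v
  simp only [adjacencyMatrix, partialAdjacency, Matrix.of_apply, Matrix.sum_apply,
    Finset.sum_filter]
  refine Finset.sum_congr rfl fun e _ => ?_
  by_cases h : G.tail e = u <;> by_cases h' : G.head e = v <;>
    simp [h, h', Matrix.vecMulVec_apply, Ne.symm]

theorem map_borderedMatrix [Fintype V] [DecidableEq V] {T T' : Type*} [CommRing T] [CommRing T']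
    (f : T →+* T') (w : E → T) (S : Finset E) {ι : Type} [DecidableEq ι] (a b : ι → V) :
    (G.borderedMatrix w S a b).map f = G.borderedMatrix (fun e => f (w e)) S a b := by
  ext (i | i) (j | j) <;>
    simp [borderedMatrix, partialAdjacency, Matrix.sum_apply, Matrix.vecMulVec_apply,
      Matrix.one_apply, Pi.single_apply, apply_ite f]

/-- The polynomial determinant identity is mapped into power series, where the path matrix inverts
`1 - A`. -/
theorem coe_flowPolynomial [Fintype V] [DecidableEq V] [Fintype E] {k : ℕ} (a b : Fin k → V) :
    (G.flowPolynomial R a b : MvPowerSeries E R) =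
      (1 - G.adjacencyMatrix R).det * ((G.pathMatrix R).submatrix a b).det := by
  have h := G.one_sub_adjacencyMatrix_mul_pathMatrix R
  rw [adjacencyMatrix_eq_partialAdjacency] at h ⊢
  rw [← det_borderedMatrix_of_right_inverse G _ _ h, flowPolynomial_eq_det,
    ← MvPolynomial.coeToMvPowerSeries.ringHom_apply, RingHom.map_det, RingHom.mapMatrix_apply,
    map_borderedMatrix]
  simp

end DirectedGraph

theorem theorem1 {V E : Type*} [Fintype V] [DecidableEq V] [Fintype E]
    (G : DirectedGraph V E) (R : Type*) [CommRing R] :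
    (IsUnit (1 - G.adjacencyMatrix R).det ∧
      G.pathMatrix R = (1 - G.adjacencyMatrix R)⁻¹) ∧
    ∃ D : (MvPowerSeries E R)ˣ, (D : MvPowerSeries E R) = (G.cyclePolynomial R : MvPowerSeries E R) ∧
      ∀ (k : ℕ) (a b : Fin k ↪ V),
        ((G.pathMatrix R).submatrix a b).det =
          (G.flowPolynomial R a b : MvPowerSeries E R) /ₚ D := by
  have hinv := G.one_sub_adjacencyMatrix_mul_pathMatrix R
  have hunit : IsUnit (1 - G.adjacencyMatrix R).det := Matrix.isUnit_det_of_right_inverse hinv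
  -- The denominator is the unit `det (1 - A)`: for `k = 0` the minor of `M` is an empty
  -- determinant, equal to `1`.
  refine ⟨⟨hunit, (Matrix.inv_eq_right_inv hinv).symm⟩, hunit.unit, ?_, fun k a b => ?_⟩
  · rw [G.cyclePolynomial_eq_flowPolynomial R Fin.elim0 Fin.elim0, G.coe_flowPolynomial]
    simp
  · rw [eq_comm, divp_eq_iff_mul_eq, G.coe_flowPolynomial, mul_comm]
    rfl
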